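/- Let $D=(V,E)$ be a finite weakly connected directed graph (loops and multiple edges allowed). For $e\in E$ let $\mathbf x_e\in\mathbb R^V$ be the vector that is $1$ at the head of $e$, $-1$ at the tail of $e$ and $0$ elsewhere ($\mathbf x_e=\mathbf 0$ if $e$ is a loop). For $S\subseteq E$ put $\tilde{\mathcal Q}_S=\operatorname{conv}(\{\mathbf 0\}\cup\{\mathbf x_e\mid e\in S\})$; the extended root polytope of $D$ is $\tilde{\mathcal Q}_D=\tilde{\mathcal Q}_E$. Let $d=\dim\tilde{\mathcal Q}_D$. The $h^*$-polynomial of $D$ is the polynomial $h^*_D(t)=\sum_{i=0}^{d}(h^*_D)_i\,t^i$ defined by $$\sum_{i=0}^{d}(h^*_D)_i\,t^i=(1-t)^{d+1}\sum_{k\ge 0}\bigl|(k\,\tilde{\mathcal Q}_D)\cap\mathbb Z^V\bigr|\,t^k ,$$ and $(h^*_D)_i=0$ for $i>d$. A spanning tree of $D$ is a set $T\subseteq E$ that, after forgetting orientations, is the edge set of a tree on the whole vertex set $V$. A dissecting tree set of $D$ is a set $\mathcal T$ of spanning trees of $D$ such that for any two different $T,T'\in\mathcal T$ the simplices $\tilde{\mathcal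 Q}_T$ and $\tilde{\mathcal Q}_{T'}$ have disjoint relative interiors, and $\bigcup_{T\in\mathcal T}\tilde{\mathcal Q}_T=\tilde{\mathcal Q}_D$. Fix a linear ordering of $E$. For a spanning tree $T$ and $e\in T$, the fundamental cut $C^*(T,e)$ is the set of edges of $D$ that connect the two components of $T-e$. The edge $e$ is internally semi-passive for $T$ if the head of the minimal edge of $C^*(T,e)$ and the head of $e$ lie in different components of $T-e$. Theorem. For every finite weakly connected digraph $D$, every dissecting tree set $\mathcal T$ of $D$, every linear ordering of the edges of $D$, and every integer $i\ge 0$, $$(h^*_D)_i=\bigl|\{T\in\mathcal T\mid T\text{ has exactly }i\text{ internally semi-passive edges}\}\bigr| .$$ -/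

import Mathlib

open scoped Pointwise

noncomputable section

section Ehrhart

variable {V : Type*}

/-- The integer lattice `ℤ^V`, as a subset of `ℝ^V`. -/
def integerPoints (V : Type*) : Set (V → ℝ) :=
  Set.range fun (z : V → ℤ) (v : V) => (z v : ℝ)

/-- The Ehrhart series `∑ₖ |(k • Q) ∩ ℤ^V| tᵏ`, the sum being over all `k ≥ 0`. -/
def ehrhartSeries (Q : Set (V → ℝ)) : PowerSeries ℤ :=
  PowerSeries.mk fun k => ((((k : ℝ) • Q) ∩ integerPoints V).ncard : ℤ)

/-- The dimension of (the affine hull of) a nonempty convex set `Q`. -/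
def polytopeDim (Q : Set (V → ℝ)) : ℕ :=
  Module.finrank ℝ (vectorSpan ℝ Q)

/-- The right hand side `(1 - t)^(d + 1) Ehr_Q(t)` of Ehrhart's identity, where `d = dim Q`. -/
def hStarSeries (Q : Set (V → ℝ)) : PowerSeries ℤ :=
  (1 - PowerSeries.X) ^ (polytopeDim Q + 1) * ehrhartSeries Q

/-- The `h*`-polynomial `∑_{i = 0}^{d} h*_i tⁱ` of a `d`-dimensional lattice polytope `Q`: the
polynomial whose coefficients of index at most `d` are those of `(1 - t)^(d + 1) Ehr_Q(t)`. -/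
def hStarPolynomial (Q : Set (V → ℝ)) : Polynomial ℤ :=
  PowerSeries.trunc (polytopeDim Q + 1) (hStarSeries Q)

end Ehrhart

/-- A directed graph with vertex set `V` and edge set `E`. Loops, parallel edges and oppositely
directed edges are all allowed. -/
structure MultiDigraph (V E : Type*) where
  tail : E → V
  head : E → V

namespace MultiDigraph

variable {V E : Type*} (D : MultiDigraph V E)

/-- The simple undirected graph on the vertex set `V` in which two distinct vertices are adjacent
if and only if some edge of the set `S` joins them, in either direction. -/
def underlying (S : Set E) : SimpleGraph V :=
  SimpleGraph.fromRel fun u v => ∃ e ∈ S, D.tail e = u ∧ D.head e = v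

/-- `D` is weakly connected: it is connected after forgetting orientations. -/
def IsWeaklyConnected : Prop :=
  (D.underlying Set.univ).Connected

/-- The edge set `T` forms a spanning tree: the undirected multigraph with vertex set `V` and edge
set `T` has no loops, no two edges with the same pair of endpoints, and the resulting simple graph
on `V` is a tree. -/
structure IsSpanningTree (T : Set E) : Prop where
  loopless : ∀ e ∈ T, D.tail e ≠ D.head e
  simple : Set.InjOn (fun e => s(D.tail e, D.head e)) T
  isTree : (D.underlying T).IsTree

/-- The vector `x_e ∈ ℝ^V`: it is `1` at the head of `e`, `-1` at the tail of `e`, and `0` at the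
other vertices; it is `0` if `e` is a loop. -/
def edgeVector [DecidableEq V] (e : E) : V → ℝ :=
  Pi.single (D.head e) 1 - Pi.single (D.tail e) 1

/-- The extended root polytope `conv ({0} ∪ {x_e | e ∈ S})` of the subgraph of `D` with vertex
set `V` and edge set `S`. -/
def extendedRootPolytopeOf [DecidableEq V] (S : Set E) : Set (V → ℝ) :=
  convexHull ℝ ({0} ∪ D.edgeVector '' S)

/-- The extended root polytope of `D`. -/
def extendedRootPolytope [DecidableEq V] : Set (V → ℝ) :=
  D.extendedRootPolytopeOf Set.univ

/-- `𝒯` is a dissecting tree set of `D`: a set of spanning trees such that the simplices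
associated to different members of `𝒯` have disjoint (relative) interiors, and the simplices
associated to the members of `𝒯` together cover exactly the extended root polytope of `D`. -/
structure IsDissectingTreeSet [DecidableEq V] (𝒯 : Set (Set E)) : Prop where
  isSpanningTree : ∀ T ∈ 𝒯, D.IsSpanningTree T
  interiorDisjoint : 𝒯.Pairwise fun T T' =>
    Disjoint (intrinsicInterior ℝ (D.extendedRootPolytopeOf T))
      (intrinsicInterior ℝ (D.extendedRootPolytopeOf T'))
  union_eq : ⋃ T ∈ 𝒯, D.extendedRootPolytopeOf T = D.extendedRootPolytope

/-- The vertices `u` and `v` lie in the same component of `T - e`. For a spanning tree `T` and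
`e ∈ T` the two components are the shores of the fundamental cut of `e`. -/
def SameShore (T : Set E) (e : E) (u v : V) : Prop :=
  (D.underlying (T \ {e})).Reachable u v

/-- The fundamental cut of `e ∈ T` with respect to the spanning tree `T`: the edges of `D` that
connect the two components of `T - e`. -/
def fundamentalCut (T : Set E) (e : E) : Set E :=
  {f | ¬ D.SameShore T e (D.tail f) (D.head f)}

/-- The edge `f` of the fundamental cut of `e` stands parallel to `e`: the heads of `e` and `f`
are in the same shore. -/
def StandsParallel (T : Set E) (e f : E) : Prop :=
  D.SameShore T e (D.head e) (D.head f)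

/-- The edge `e ∈ T` is internally semi-passive for the spanning tree `T`, with respect to the
given ordering of the edges: the minimal edge of the fundamental cut of `e` stands opposite
to `e`. -/
def IsInternallySemiPassive [LinearOrder E] (T : Set E) (e : E) : Prop :=
  e ∈ T ∧ ∃ f, IsLeast (D.fundamentalCut T e) f ∧ ¬ D.StandsParallel T e f

/-- The internal semi-passivity of `T`: the number of its internally semi-passive edges. -/
def internalSemiPassivity [LinearOrder E] (T : Set E) : ℕ :=
  {e | D.IsInternallySemiPassive T e}.ncard

end MultiDigraph

end

/-! The vectors of a spanning tree `T` form a lattice basis of the integer vectors with coordinate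
sum zero; the dual coordinates are the functionals `cutFunctional T e`, which take the values 0, 1,
-1 on edge vectors according to the position of the edge relative to the cut of `e`.

Take a small combination `q` of all edge vectors with positive weights, each exceeding the sum of
all later ones. The minimal edge of each fundamental cut then dominates, so the `e`-coordinate of
`q` is nonzero, and negative exactly when `e` is internally semi-passive (`cutFunctional_sum_sign`,
`exists_generic_point`). Remove from each simplex the facets that separate it from `q`. A lattice
point `x` of the `k`-th dilate belongs to a half-open dilated simplex iff `x + δ q` is interior to
the `(k + δ)`-dilate for small `δ > 0`, so a dissection partitions the lattice points
(`smul_inter_integerPoints`).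

By unimodularity, a half-open simplex with `i` facets removed has Ehrhart series `t^i / (1 - t)^(d +
1)` (`ncard_halfOpenPoints`). Summing over the trees gives the theorem. -/

open Filter Topology

namespace MultiDigraph

/-! ### Fundamental cuts of a spanning tree -/

section Shores

variable {V E : Type*} (D : MultiDigraph V E) {T : Set E}

lemma underlying_adj {S : Set E} {u v : V} :
    (D.underlying S).Adj u v ↔ u ≠ v ∧ ((∃ e ∈ S, D.tail e = u ∧ D.head e = v) ∨
      ∃ e ∈ S, D.tail e = v ∧ D.head e = u) :=
  SimpleGraph.fromRel_adj _ _ _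

variable {D}

lemma sameShore_of_mem {e f : E} (hf : f ∈ T) (hne : f ≠ e) :
    D.SameShore T e (D.tail f) (D.head f) := by
  unfold SameShore
  by_cases h : D.tail f = D.head f
  · rw [h]
  · exact SimpleGraph.Adj.reachable
      ((D.underlying_adj).2 ⟨h, .inl ⟨f, ⟨hf, hne⟩, rfl, rfl⟩⟩)

/-- Every edge of a tree is a bridge; injectivity on endpoint pairs ensures that no parallel tree
edge survives the removal of `e`. -/
lemma IsSpanningTree.not_sameShore (hT : D.IsSpanningTree T) {e : E} (he : e ∈ T) :
    ¬ D.SameShore T e (D.tail e) (D.head e) := by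
  have hadj : (D.underlying T).Adj (D.tail e) (D.head e) :=
    (D.underlying_adj).2 ⟨hT.loopless e he, .inl ⟨e, he, rfl, rfl⟩⟩
  have hbridge := SimpleGraph.isBridge_iff.1
    (SimpleGraph.isAcyclic_iff_forall_adj_isBridge.1 hT.isTree.isAcyclic hadj)
  refine fun h => hbridge (h.mono fun u v huv => ?_)
  obtain ⟨hne, h⟩ := (D.underlying_adj).1 huv
  rw [SimpleGraph.deleteEdges_adj, Set.mem_singleton_iff, underlying_adj]
  rcases h with ⟨f, hf, rfl, rfl⟩ | ⟨f, hf, rfl, rfl⟩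
  · exact ⟨⟨hne, .inl ⟨f, hf.1, rfl, rfl⟩⟩, fun h => hf.2 (hT.simple hf.1 he h)⟩
  · exact ⟨⟨hne, .inr ⟨f, hf.1, rfl, rfl⟩⟩,
      fun h => hf.2 (hT.simple hf.1 he (Sym2.eq_swap.trans h))⟩

/-- Walk from the head of `e` to `v` in the tree: each step stays in its shore unless it traverses
`e`, which lands on an end of `e`. -/
lemma IsSpanningTree.sameShore_head_or_tail (hT : D.IsSpanningTree T) (e : E) (v : V) :
    D.SameShore T e (D.head e) v ∨ D.SameShore T e (D.tail e) v := by
  have h := (SimpleGraph.reachable_iff_reflTransGen _ _).1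
    (hT.isTree.connected.preconnected (D.head e) v)
  induction h with
  | refl => exact .inl (SimpleGraph.Reachable.refl _)
  | tail _ hadj ih =>
    obtain ⟨-, ⟨f, hf, rfl, rfl⟩ | ⟨f, hf, rfl, rfl⟩⟩ := (D.underlying_adj).1 hadj
    · by_cases hfe : f = e
      · subst hfe
        exact .inl (SimpleGraph.Reachable.refl _)
      · exact ih.imp (fun h => h.trans (sameShore_of_mem hf hfe))
          (fun h => h.trans (sameShore_of_mem hf hfe))
    · by_cases hfe : f = e
      · subst hfe
        exact .inr (SimpleGraph.Reachable.refl _)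
      · exact ih.imp (fun h => h.trans (sameShore_of_mem hf hfe).symm)
          (fun h => h.trans (sameShore_of_mem hf hfe).symm)

end Shores

/-! ### Cut functionals as the dual basis of a spanning tree -/

section CutFunctional

variable {V E : Type*} [Fintype V] (D : MultiDigraph V E) {T : Set E}

open Classical in
/-- The sum of the coordinates over the shore of the fundamental cut of `e` that contains the head
of `e`. -/
noncomputable def cutFunctional (T : Set E) (e : E) : (V → ℝ) →ₗ[ℝ] ℝ :=
  ∑ v with D.SameShore T e (D.head e) v, LinearMap.proj v

/-- The sum of the functionals of all fundamental cuts of `T`. -/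
noncomputable def height (T : Set E) [Fintype T] : (V → ℝ) →ₗ[ℝ] ℝ :=
  ∑ e : T, D.cutFunctional T e

lemma height_apply [Fintype T] (x : V → ℝ) :
    D.height T x = ∑ e : T, D.cutFunctional T e x := by
  simp [height]

/-- This integrality of the tree coordinates is the unimodularity of the simplices. -/
lemma cutFunctional_intCast (e : E) (z : V → ℤ) :
    ∃ n : ℤ, D.cutFunctional T e (fun v => (z v : ℝ)) = n := by
  classical
  exact ⟨∑ v with D.SameShore T e (D.head e) v, z v, by simp [cutFunctional]⟩

variable [DecidableEq V]

open Classical in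
lemma cutFunctional_edgeVector (e f : E) :
    D.cutFunctional T e (D.edgeVector f) =
      (if D.SameShore T e (D.head e) (D.head f) then 1 else 0) -
        (if D.SameShore T e (D.head e) (D.tail f) then 1 else 0) := by
  simp [cutFunctional, edgeVector, Finset.sum_sub_distrib, Pi.single_apply]

lemma sum_edgeVector (e : E) : ∑ v, D.edgeVector e v = 0 := by
  simp [edgeVector]

lemma abs_cutFunctional_edgeVector_le (e f : E) :
    |D.cutFunctional T e (D.edgeVector f)| ≤ 1 := by
  rw [cutFunctional_edgeVector]
  split_ifs <;> simp

variable {D}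

lemma cutFunctional_edgeVector_eq_zero {e f : E} (hf : f ∉ D.fundamentalCut T e) :
    D.cutFunctional T e (D.edgeVector f) = 0 := by
  have hf : D.SameShore T e (D.tail f) (D.head f) := not_not.1 hf
  have : D.SameShore T e (D.head e) (D.head f) ↔ D.SameShore T e (D.head e) (D.tail f) :=
    ⟨fun h => h.trans hf.symm, fun h => h.trans hf⟩
  rw [cutFunctional_edgeVector]
  by_cases h : D.SameShore T e (D.head e) (D.tail f)
  · rw [if_pos (this.2 h), if_pos h, sub_self]
  · rw [if_neg (mt this.1 h), if_neg h, sub_self]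

lemma cutFunctional_edgeVector_of_standsParallel {e f : E} (hf : f ∈ D.fundamentalCut T e)
    (h : D.StandsParallel T e f) : D.cutFunctional T e (D.edgeVector f) = 1 := by
  have ht : ¬ D.SameShore T e (D.head e) (D.tail f) := fun ht => hf (ht.symm.trans h)
  rw [cutFunctional_edgeVector, if_pos (show D.SameShore T e _ _ from h), if_neg ht, sub_zero]

lemma IsSpanningTree.cutFunctional_edgeVector_of_not_standsParallel (hT : D.IsSpanningTree T)
    {e f : E} (hf : f ∈ D.fundamentalCut T e) (h : ¬ D.StandsParallel T e f) :
    D.cutFunctional T e (D.edgeVector f) = -1 := by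
  have h1 := (hT.sameShore_head_or_tail e (D.head f)).resolve_left h
  have ht : D.SameShore T e (D.head e) (D.tail f) :=
    (hT.sameShore_head_or_tail e (D.tail f)).resolve_right fun h2 => hf (h2.symm.trans h1)
  rw [cutFunctional_edgeVector, if_neg (show ¬ D.SameShore T e _ _ from h), if_pos ht, zero_sub]

lemma IsSpanningTree.cutFunctional_edgeVector_self (hT : D.IsSpanningTree T) {e : E}
    (he : e ∈ T) : D.cutFunctional T e (D.edgeVector e) = 1 :=
  cutFunctional_edgeVector_of_standsParallel (hT.not_sameShore he) (SimpleGraph.Reachable.refl _)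

-- Duality: `e` is the only edge of `T` in its own fundamental cut.
open Classical in
lemma IsSpanningTree.cutFunctional_edgeVector_of_mem (hT : D.IsSpanningTree T) (e f : T) :
    D.cutFunctional T e (D.edgeVector f) = if f = e then 1 else 0 := by
  split_ifs with h
  · rw [h, hT.cutFunctional_edgeVector_self e.2]
  · exact cutFunctional_edgeVector_eq_zero
      fun hc => hc (sameShore_of_mem f.2 fun h' => h (Subtype.ext h'))

lemma IsSpanningTree.cutFunctional_sum (hT : D.IsSpanningTree T) [Fintype T] (c : T → ℝ)
    (e : T) : D.cutFunctional T e (∑ f : T, c f • D.edgeVector f) = c e := by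
  classical
  simp [hT.cutFunctional_edgeVector_of_mem]

lemma IsSpanningTree.linearIndependent (hT : D.IsSpanningTree T) [Fintype T] :
    LinearIndependent ℝ fun e : T => D.edgeVector (e : E) := by
  refine Fintype.linearIndependent_iff.2 fun c hc e => ?_
  rw [← hT.cutFunctional_sum c e, hc, map_zero]

-- Telescoping along the tree path from `u` to `v`.
omit [Fintype V] in
lemma IsSpanningTree.single_sub_single_mem_span (hT : D.IsSpanningTree T) (u v : V) :
    (Pi.single v 1 - Pi.single u 1 : V → ℝ) ∈
      Submodule.span ℝ (Set.range fun e : T => D.edgeVector (e : E)) := by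
  have h := (SimpleGraph.reachable_iff_reflTransGen _ _).1
    (hT.isTree.connected.preconnected u v)
  induction h with
  | refl => simp
  | @tail a b _ hadj ih =>
    have hab : (Pi.single b 1 - Pi.single a 1 : V → ℝ) ∈
        Submodule.span ℝ (Set.range fun e : T => D.edgeVector (e : E)) := by
      obtain ⟨-, ⟨f, hf, rfl, rfl⟩ | ⟨f, hf, rfl, rfl⟩⟩ := (D.underlying_adj).1 hadj
      · exact Submodule.subset_span ⟨⟨f, hf⟩, rfl⟩
      · rw [← neg_sub]
        exact Submodule.neg_mem _ (Submodule.subset_span ⟨⟨f, hf⟩, rfl⟩)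
    simpa using Submodule.add_mem _ hab ih

lemma IsSpanningTree.mem_span (hT : D.IsSpanningTree T) {x : V → ℝ} (hx : ∑ v, x v = 0) :
    x ∈ Submodule.span ℝ (Set.range fun e : T => D.edgeVector (e : E)) := by
  obtain ⟨u⟩ := hT.isTree.connected.nonempty
  have : x = ∑ v, x v • (Pi.single v 1 - Pi.single u 1 : V → ℝ) := by
    simp only [smul_sub, Finset.sum_sub_distrib, ← Finset.sum_smul, hx, zero_smul, sub_zero]
    exact (pi_eq_sum_univ' x).trans (by simp)
  rw [this]
  exact Submodule.sum_mem _ fun v _ =>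
    Submodule.smul_mem _ _ (hT.single_sub_single_mem_span u v)

lemma IsSpanningTree.sum_cutFunctional_smul (hT : D.IsSpanningTree T) [Fintype T] {x : V → ℝ}
    (hx : ∑ v, x v = 0) : ∑ e : T, D.cutFunctional T e x • D.edgeVector (e : E) = x := by
  obtain ⟨c, rfl⟩ := (Submodule.mem_span_range_iff_exists_fun ℝ).1 (hT.mem_span hx)
  simp_rw [hT.cutFunctional_sum]

end CutFunctional

/-! ### Facet inequalities, interiors and dimension -/

section Polytope

variable {V E : Type*} [DecidableEq V] (D : MultiDigraph V E)

lemma zero_mem_extendedRootPolytopeOf (S : Set E) : 0 ∈ D.extendedRootPolytopeOf S :=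
  subset_convexHull ℝ _ (.inl rfl)

lemma convex_extendedRootPolytopeOf (S : Set E) : Convex ℝ (D.extendedRootPolytopeOf S) :=
  convex_convexHull ℝ _

lemma sum_smul_mem_extendedRootPolytopeOf (S : Set E) [Fintype S] {c : S → ℝ}
    (hc : ∀ e, 0 ≤ c e) (hs : ∑ e, c e ≤ 1) :
    ∑ e, c e • D.edgeVector (e : E) ∈ D.extendedRootPolytopeOf S := by
  -- The index `none` puts the missing weight `1 - ∑ c` on the vertex 0.
  have := (D.convex_extendedRootPolytopeOf S).sum_mem (t := Finset.univ)
    (w := fun o : Option S => o.elim (1 - ∑ e, c e) c)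
    (z := fun o : Option S => o.elim 0 fun e => D.edgeVector (e : E))
    (by rintro (_ | e) -; exacts [sub_nonneg.2 hs, hc e]) (by simp [Fintype.sum_option])
    (by
      rintro (_ | e) -
      exacts [D.zero_mem_extendedRootPolytopeOf S,
        subset_convexHull ℝ _ (.inr ⟨e, e.2, rfl⟩)])
  simpa [Fintype.sum_option] using this

variable {D} [Fintype V] {T : Set E}

lemma sum_eq_zero_of_mem_extendedRootPolytopeOf {S : Set E} {x : V → ℝ}
    (hx : x ∈ D.extendedRootPolytopeOf S) : ∑ v, x v = 0 := by
  let W : Submodule ℝ (V → ℝ) := LinearMap.ker (∑ v, LinearMap.proj v)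
  have : D.extendedRootPolytopeOf S ⊆ W := by
    refine convexHull_min ?_ W.convex
    rintro _ (rfl | ⟨e, -, rfl⟩)
    · exact W.zero_mem
    · simpa [W] using D.sum_edgeVector e
  simpa [W] using this hx

/-- In tree coordinates this is the standard simplex; `height` is the coordinate sum, so its
inequality is the facet opposite to 0. -/
lemma IsSpanningTree.mem_extendedRootPolytopeOf_iff (hT : D.IsSpanningTree T) [Fintype T]
    {x : V → ℝ} : x ∈ D.extendedRootPolytopeOf T ↔
      ∑ v, x v = 0 ∧ (∀ e ∈ T, 0 ≤ D.cutFunctional T e x) ∧ D.height T x ≤ 1 := by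
  classical
  constructor
  · intro hx
    refine ⟨sum_eq_zero_of_mem_extendedRootPolytopeOf hx, fun e he => ?_, ?_⟩
    · refine convexHull_min (t := {x | 0 ≤ D.cutFunctional T e x}) ?_
        (convex_halfSpace_ge (D.cutFunctional T e).isLinear 0) hx
      rintro _ (rfl | ⟨f, hf, rfl⟩)
      · simp
      · have := hT.cutFunctional_edgeVector_of_mem ⟨e, he⟩ ⟨f, hf⟩
        simp only at this
        rw [Set.mem_ofPred_eq, this]
        split_ifs <;> simp
    · refine convexHull_min (t := {x | D.height T x ≤ 1}) ?_
        (convex_halfSpace_le (D.height T).isLinear 1) hx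
      rintro _ (rfl | ⟨f, hf, rfl⟩)
      · simp
      · have := fun e => hT.cutFunctional_edgeVector_of_mem e ⟨f, hf⟩
        simp only at this
        simp [height_apply, this]
  · rintro ⟨h0, h1, h2⟩
    rw [← hT.sum_cutFunctional_smul h0]
    exact D.sum_smul_mem_extendedRootPolytopeOf T (fun e => h1 e e.2)
      (by rwa [height_apply] at h2)

lemma IsSpanningTree.mem_smul_extendedRootPolytopeOf_iff (hT : D.IsSpanningTree T) [Fintype T]
    {x : V → ℝ} {r : ℝ} (hr : 0 ≤ r) : x ∈ r • D.extendedRootPolytopeOf T ↔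
      ∑ v, x v = 0 ∧ (∀ e ∈ T, 0 ≤ D.cutFunctional T e x) ∧ D.height T x ≤ r := by
  -- The zero dilate is handled apart: nonnegative coordinates with sum at most 0 all vanish.
  rcases hr.eq_or_lt with rfl | hr
  · rw [Set.zero_smul_set ⟨0, D.zero_mem_extendedRootPolytopeOf T⟩, Set.mem_zero]
    constructor
    · rintro rfl
      simp
    · rintro ⟨h0, h1, h2⟩
      rw [height_apply] at h2
      have h3 := (Finset.sum_eq_zero_iff_of_nonneg fun (e : T) _ => h1 e e.2).1
        (h2.antisymm (Finset.sum_nonneg fun e _ => h1 e e.2))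
      rw [← hT.sum_cutFunctional_smul h0]
      exact Finset.sum_eq_zero fun e he => by rw [h3 e he, zero_smul]
  · rw [Set.mem_smul_set_iff_inv_smul_mem₀ hr.ne', hT.mem_extendedRootPolytopeOf_iff]
    simp only [Pi.smul_apply, smul_eq_mul, ← Finset.mul_sum, map_smul]
    simp [hr.ne', mul_nonneg_iff_of_pos_left (inv_pos.2 hr), inv_mul_le_iff₀ hr]

/-- The affine span lies in the hyperplane of coordinate sum zero, where the strict inequalities
define an open subset of the simplex. -/
lemma IsSpanningTree.mem_intrinsicInterior (hT : D.IsSpanningTree T) [Fintype T] {x : V → ℝ}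
    (h0 : ∑ v, x v = 0) (h1 : ∀ e ∈ T, 0 < D.cutFunctional T e x) (h2 : D.height T x < 1) :
    x ∈ intrinsicInterior ℝ (D.extendedRootPolytopeOf T) := by
  have hx : x ∈ D.extendedRootPolytopeOf T :=
    hT.mem_extendedRootPolytopeOf_iff.2 ⟨h0, fun e he => (h1 e he).le, h2.le⟩
  refine _root_.mem_intrinsicInterior.2 ⟨⟨x, subset_affineSpan ℝ _ hx⟩, ?_, rfl⟩
  let U : Set (V → ℝ) := (⋂ e : T, {y | 0 < D.cutFunctional T e y}) ∩ {y | D.height T y < 1}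
  have hU : IsOpen U := (isOpen_iInter_of_finite fun e : T =>
    isOpen_lt continuous_const (D.cutFunctional T e).continuous_of_finiteDimensional).inter
    (isOpen_lt (D.height T).continuous_of_finiteDimensional continuous_const)
  refine mem_interior.2 ⟨Subtype.val ⁻¹' U, ?_, hU.preimage continuous_subtype_val, ?_⟩
  · rintro ⟨y, hy⟩ ⟨hy1, hy2⟩
    let W : Submodule ℝ (V → ℝ) := LinearMap.ker (∑ v, LinearMap.proj v)
    have hW : affineSpan ℝ (D.extendedRootPolytopeOf T) ≤ W.toAffineSubspace :=
      affineSpan_le.2 fun z hz => by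
        simpa [W] using sum_eq_zero_of_mem_extendedRootPolytopeOf hz
    refine hT.mem_extendedRootPolytopeOf_iff.2 ⟨?_, fun e he => ?_, le_of_lt hy2⟩
    · simpa [W] using hW hy
    · exact le_of_lt (Set.mem_iInter.1 hy1 ⟨e, he⟩)
  · exact ⟨Set.mem_iInter.2 fun e => h1 e e.2, h2⟩

lemma IsSpanningTree.polytopeDim_eq (hT : D.IsSpanningTree T) [Fintype T] :
    polytopeDim D.extendedRootPolytope = Fintype.card T := by
  rw [polytopeDim, extendedRootPolytope, vectorSpan_eq_span_vsub_set_right ℝ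
    (D.zero_mem_extendedRootPolytopeOf Set.univ), ← finrank_span_eq_card hT.linearIndependent]
  suffices h : Submodule.span ℝ ((· -ᵥ (0 : V → ℝ)) '' D.extendedRootPolytopeOf Set.univ) =
      Submodule.span ℝ (Set.range fun e : T => D.edgeVector (e : E)) by rw [h]
  apply le_antisymm <;> rw [Submodule.span_le]
  · rintro _ ⟨x, hx, rfl⟩
    simpa using hT.mem_span (sum_eq_zero_of_mem_extendedRootPolytopeOf hx)
  · rintro _ ⟨e, rfl⟩
    exact Submodule.subset_span ⟨_, subset_convexHull ℝ _ (.inr ⟨e, trivial, rfl⟩),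
      by simp⟩

end Polytope

end MultiDigraph

/-! ### Dominating weights, perturbation and a generating function -/

lemma exists_pos_sum_gt_lt (E : Type*) [Fintype E] [LinearOrder E] :
    ∃ ε : E → ℝ, (∀ f, 0 < ε f) ∧ ∀ f, ∑ g with f < g, ε g < ε f := by
  suffices h : ∀ s : Finset E, ∃ ε : E → ℝ, (∀ f, 0 < ε f) ∧
      ∀ f ∈ s, ∑ g ∈ s with f < g, ε g < ε f by
    obtain ⟨ε, h1, h2⟩ := h Finset.univ
    exact ⟨ε, h1, fun f => h2 f (Finset.mem_univ f)⟩
  intro s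
  induction s using Finset.induction_on_min with
  | empty => exact ⟨1, by simp⟩
  | insert a s ha ih =>
    obtain ⟨ε, h1, h2⟩ := ih
    have has : a ∉ s := fun h => lt_irrefl _ (ha a h)
    have hsum : ∀ t ⊆ s, ∑ g ∈ t, Function.update ε a (1 + ∑ g ∈ s, ε g) g = ∑ g ∈ t, ε g :=
      fun t ht => Finset.sum_congr rfl fun g hg =>
        Function.update_of_ne (ne_of_mem_of_not_mem (ht hg) has) _ _
    -- The new element is the minimum, so it alone has to outweigh everything chosen before.
    refine ⟨Function.update ε a (1 + ∑ g ∈ s, ε g), fun f => ?_, fun f hf => ?_⟩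
    · rcases eq_or_ne f a with rfl | h
      · rw [Function.update_self]
        have := Finset.sum_nonneg fun g (_ : g ∈ s) => (h1 g).le
        positivity
      · rw [Function.update_of_ne h]
        exact h1 f
    · rcases Finset.mem_insert.1 hf with rfl | h
      · rw [Function.update_self, Finset.filter_insert, if_neg (lt_irrefl _),
          Finset.filter_true_of_mem ha, hsum s subset_rfl]
        linarith
      · rw [Function.update_of_ne (ne_of_mem_of_not_mem h has), Finset.filter_insert,
          if_neg (ha f h).not_gt, hsum _ (Finset.filter_subset _ _)]
        exact h2 f h

/-- Whether a point with coordinate `a`, when moved towards a point with coordinate `b ≠ 0`, has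
a positive coordinate. -/
lemma eventually_nonneg_add_mul {a b : ℝ} (hb : b ≠ 0) : ∀ᶠ δ in 𝓝[>] (0 : ℝ),
    (0 ≤ a + δ * b → 0 ≤ a ∧ (b < 0 → 0 < a)) ∧
      (0 ≤ a → (b < 0 → 0 < a) → 0 < a + δ * b) := by
  have hlim : Tendsto (fun δ : ℝ => a + δ * b) (𝓝[>] 0) (𝓝 a) := by
    refine (Continuous.tendsto' (by fun_prop) 0 a (by simp)).mono_left nhdsWithin_le_nhds
  rcases lt_trichotomy a 0 with ha | rfl | ha
  · filter_upwards [hlim.eventually_lt_const ha] with δ hδ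
    exact ⟨fun h => absurd h hδ.not_ge, fun h => absurd h ha.not_ge⟩
  · filter_upwards [self_mem_nhdsWithin] with δ (hδ : 0 < δ)
    rw [zero_add]
    rcases hb.lt_or_gt with hb | hb
    · exact ⟨fun h => absurd h (mul_neg_of_pos_of_neg hδ hb).not_ge,
        fun _ h => absurd (h hb) (lt_irrefl _)⟩
    · exact ⟨fun _ => ⟨le_rfl, fun h => absurd h hb.not_gt⟩, fun _ _ => mul_pos hδ hb⟩
  · filter_upwards [hlim.eventually_const_lt ha] with δ hδ
    exact ⟨fun _ => ⟨ha.le, fun _ => ha⟩, fun _ _ => hδ⟩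

-- The series `mk 1` is `1 / (1 - X)`. Each index in `A` contributes `X / (1 - X)`, every other one
-- `1 / (1 - X)`, and the slack index `none` the extra factor.
open Classical in
lemma PowerSeries.card_filter_finsuppAntidiag {ι : Type*} [Fintype ι] (A : ι → Prop) (k : ℕ) :
    (((Finset.univ.finsuppAntidiag k).filter
        fun l : Option ι →₀ ℕ => ∀ i, A i → l (some i) ≠ 0).card : ℤ) =
      PowerSeries.coeff k
        (PowerSeries.X ^ (Finset.univ.filter A).card *
          PowerSeries.mk (1 : ℕ → ℤ) ^ (Fintype.card ι + 1)) := by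
  have hprod : (PowerSeries.X ^ (Finset.univ.filter A).card *
      PowerSeries.mk (1 : ℕ → ℤ) ^ (Fintype.card ι + 1)) =
      ∏ o : Option ι, o.elim (PowerSeries.mk (1 : ℕ → ℤ))
        fun i => (if A i then PowerSeries.X else 1) * PowerSeries.mk (1 : ℕ → ℤ) := by
    rw [Fintype.prod_option]
    simp only [Option.elim, Finset.prod_mul_distrib, Finset.prod_const, Finset.card_univ]
    rw [Finset.prod_ite]
    simp only [Finset.prod_const, one_pow, mul_one]
    ring
  rw [hprod, PowerSeries.coeff_prod, Finset.card_filter, Nat.cast_sum]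
  refine Finset.sum_congr rfl fun l _ => ?_
  have hfac : ∀ i, PowerSeries.coeff (l (some i))
      ((if A i then PowerSeries.X else 1) * PowerSeries.mk (1 : ℕ → ℤ)) =
      if A i → l (some i) ≠ 0 then 1 else 0 := by
    intro i
    by_cases hA : A i
    · rcases h : l (some i) with _ | n
      · simp [hA]
      · simp [hA, PowerSeries.coeff_succ_X_mul]
    · simp [hA]
  rw [Fintype.prod_option]
  simp only [Option.elim, hfac]
  rw [Finset.prod_ite_zero]
  simp

namespace MultiDigraph

variable {V E : Type*} [Fintype V] [DecidableEq V] {D : MultiDigraph V E} {T : Set E}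

/-! ### The generic point -/

section Generic

variable [Fintype E] [LinearOrder E]

/-- Edges before the minimal cut edge `f` contribute 0, and those after it sum to less than `ε f` in
absolute value, so the sign is that of the term of `f`. -/
lemma IsSpanningTree.cutFunctional_sum_sign (hT : D.IsSpanningTree T) {ε : E → ℝ}
    (hpos : ∀ f, 0 < ε f) (hlex : ∀ f, ∑ g with f < g, ε g < ε f) {e : E} (he : e ∈ T) :
    D.cutFunctional T e (∑ f, ε f • D.edgeVector f) ≠ 0 ∧
      (D.IsInternallySemiPassive T e ↔
        D.cutFunctional T e (∑ f, ε f • D.edgeVector f) < 0) := by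
  classical
  obtain ⟨f, hf⟩ : ∃ f, IsLeast (D.fundamentalCut T e) f :=
    (Set.toFinite _).exists_minimal ⟨e, hT.not_sameShore he⟩ |>.imp fun f hf =>
      ⟨hf.1, fun g hg => (le_total f g).elim id fun h => hf.2 hg h⟩
  have hpassive : D.IsInternallySemiPassive T e ↔ ¬ D.StandsParallel T e f :=
    ⟨fun ⟨_, g, hg, h⟩ => hf.unique hg ▸ h, fun h => ⟨he, f, hf, h⟩⟩
  set c : E → ℝ := fun g => D.cutFunctional T e (D.edgeVector g) with hc
  have hq : D.cutFunctional T e (∑ g, ε g • D.edgeVector g) =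
      ε f * c f + ∑ g with f < g, ε g * c g := by
    rw [map_sum, ← Finset.add_sum_erase _ _ (Finset.mem_univ f), map_smul, smul_eq_mul]
    congr 1
    have herase := Finset.sum_erase (a := f) Finset.univ
      (f := fun g => if f < g then ε g * c g else 0) (if_neg (lt_irrefl f))
    rw [Finset.sum_filter, ← herase]
    refine Finset.sum_congr rfl fun g hg => ?_
    rw [map_smul, smul_eq_mul]
    split_ifs with h
    · rfl
    · rw [cutFunctional_edgeVector_eq_zero, mul_zero]
      exact fun hg' => h ((hf.2 hg').lt_of_ne (Finset.ne_of_mem_erase hg).symm)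
  have hrest : |∑ g with f < g, ε g * c g| < ε f := by
    refine ((Finset.abs_sum_le_sum_abs _ _).trans (Finset.sum_le_sum fun g _ => ?_)).trans_lt
      (hlex f)
    rw [abs_mul, abs_of_pos (hpos g)]
    exact mul_le_of_le_one_right (hpos g).le (D.abs_cutFunctional_edgeVector_le e g)
  rw [abs_lt] at hrest
  rw [hq, hpassive]
  by_cases hpar : D.StandsParallel T e f
  · have : c f = 1 := cutFunctional_edgeVector_of_standsParallel hf.1 hpar
    rw [this, mul_one]
    have h : 0 < ε f + ∑ g with f < g, ε g * c g := by linarith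
    exact ⟨h.ne', by simp [hpar, h.le]⟩
  · have : c f = -1 := hT.cutFunctional_edgeVector_of_not_standsParallel hf.1 hpar
    rw [this]
    have h : ε f * -1 + ∑ g with f < g, ε g * c g < 0 := by linarith
    exact ⟨h.ne, by simpa [hpar] using h⟩

/-- The polytope contains a point that lies on none of the hyperplanes of fundamental cuts, such
that an edge is internally semi-passive exactly if this point is beyond its facet. -/
lemma exists_generic_point (D : MultiDigraph V E) : ∃ q ∈ D.extendedRootPolytope,
    ∀ (T : Set E) [Fintype T], D.IsSpanningTree T → D.height T q < 1 ∧
      ∀ e ∈ T, D.cutFunctional T e q ≠ 0 ∧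
        (D.IsInternallySemiPassive T e ↔ D.cutFunctional T e q < 0) := by
  obtain ⟨ε, hpos, hlex⟩ := exists_pos_sum_gt_lt E
  have hS : 0 ≤ ∑ f, ε f := Finset.sum_nonneg fun f _ => (hpos f).le
  set S := ∑ f, ε f
  -- Scaling preserves signs. This factor makes the total weight at most 1, so that `q` is in the
  -- polytope, and bounds the sum of up to `card E` cut functionals strictly below 1.
  set η : ℝ := ((Fintype.card E + 1) * (S + 1))⁻¹ with hη
  have hη0 : 0 < η := by positivity
  have hηS : (Fintype.card E + 1) * (η * S) < 1 := by
    rw [hη, mul_inv]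
    field_simp
    linarith
  have hηS' : η * S ≤ 1 := by
    nlinarith [mul_nonneg hη0.le hS, (Nat.cast_nonneg _ : (0 : ℝ) ≤ Fintype.card E)]
  refine ⟨∑ f, (η * ε f) • D.edgeVector f, ?_, fun T _ hT => ⟨?_, fun e he => ?_⟩⟩
  · have := D.sum_smul_mem_extendedRootPolytopeOf Set.univ (c := fun e => η * ε e)
      (fun e => (mul_pos hη0 (hpos e)).le) (by
        rw [← Finset.mul_sum]
        convert hηS' using 2
        exact (Equiv.Set.univ E).sum_comp ε)
    rw [extendedRootPolytope]
    convert this using 1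
    exact ((Equiv.Set.univ E).sum_comp fun e => (η * ε e) • D.edgeVector e).symm
  · have hcut : ∀ e : T, D.cutFunctional T e (∑ f, (η * ε f) • D.edgeVector f) ≤ η * S := by
      intro e
      rw [map_sum, Finset.mul_sum]
      refine Finset.sum_le_sum fun f _ => ?_
      rw [map_smul, smul_eq_mul]
      exact mul_le_of_le_one_right (mul_pos hη0 (hpos f)).le
        ((le_abs_self _).trans (D.abs_cutFunctional_edgeVector_le _ f))
    rw [height_apply]
    refine (Finset.sum_le_sum fun e _ => hcut e).trans_lt ?_
    have hcard : (Fintype.card T : ℝ) ≤ Fintype.card E := by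
      exact_mod_cast Fintype.card_le_of_injective _ Subtype.val_injective
    simp only [Finset.sum_const, Finset.card_univ, nsmul_eq_mul]
    nlinarith [mul_nonneg hη0.le hS]
  · refine hT.cutFunctional_sum_sign (fun f => mul_pos hη0 (hpos f)) (fun f => ?_) he
    rw [← Finset.mul_sum]
    exact mul_lt_mul_of_pos_left (hlex f) hη0

end Generic

end MultiDigraph

/-! ### Lattice points of half-open unimodular simplices -/

namespace MultiDigraph

variable {V E : Type*} [Fintype V] [DecidableEq V] {D : MultiDigraph V E} {T : Set E}

/-- The integer points of the `k`-th dilation of the simplex of `T` with the facets opposite to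
the vertices `x_e` with `e ∈ A` removed. -/
def halfOpenPoints (D : MultiDigraph V E) (T A : Set E) [Fintype T] (k : ℕ) : Set (V → ℝ) :=
  {x | x ∈ integerPoints V ∧ ∑ v, x v = 0 ∧
    (∀ e ∈ T, 0 ≤ D.cutFunctional T e x ∧ (e ∈ A → 0 < D.cutFunctional T e x)) ∧
    D.height T x ≤ k}

lemma IsSpanningTree.halfOpenPoints_subset (hT : D.IsSpanningTree T) [Fintype T] (A : Set E)
    (k : ℕ) : D.halfOpenPoints T A k ⊆ (k : ℝ) • D.extendedRootPolytopeOf T :=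
  fun _ ⟨_, h0, h1, h2⟩ => (hT.mem_smul_extendedRootPolytopeOf_iff k.cast_nonneg).2
    ⟨h0, fun e he => (h1 e he).1, h2⟩

omit [Fintype V] in
lemma sum_smul_edgeVector_mem_integerPoints [Fintype T] (c : T → ℕ) :
    ∑ e : T, (c e : ℝ) • D.edgeVector (e : E) ∈ integerPoints V := by
  refine ⟨∑ e : T, (c e : ℤ) • (Pi.single (D.head e) 1 - Pi.single (D.tail e) 1), ?_⟩
  ext v
  simp [edgeVector, Finset.sum_apply, Pi.single_apply]

open Classical in
lemma IsSpanningTree.halfOpenPoints_eq_image (hT : D.IsSpanningTree T) [Fintype T] (A : Set E)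
    (k : ℕ) : D.halfOpenPoints T A k =
      (fun l : Option T →₀ ℕ => ∑ e : T, (l (some e) : ℝ) • D.edgeVector (e : E)) ''
        ((Finset.univ.finsuppAntidiag k).filter
          fun l : Option T →₀ ℕ => ∀ e : T, (e : E) ∈ A → l (some e) ≠ 0 :
            Finset (Option T →₀ ℕ)) := by
  ext x
  constructor
  · rintro ⟨⟨z, rfl⟩, h0, h1, h2⟩
    have hc : ∀ e : T, ∃ n : ℕ, D.cutFunctional T e (fun v => (z v : ℝ)) = n := by
      intro e
      obtain ⟨n, hn⟩ := D.cutFunctional_intCast (T := T) e z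
      have hn0 := (h1 e e.2).1
      rw [hn] at hn0
      lift n to ℕ using by exact_mod_cast hn0
      exact ⟨n, hn⟩
    choose c hc using hc
    rw [height_apply] at h2
    simp only [hc] at h2
    have h2' : ∑ e, c e ≤ k := by exact_mod_cast h2
    -- The slack entry `none` turns a coordinate sum at most `k` into a total of exactly `k`.
    refine ⟨Finsupp.equivFunOnFinite.symm fun o => o.elim (k - ∑ e, c e) c, ?_, ?_⟩
    · rw [Finset.mem_coe, Finset.mem_filter, Finset.mem_finsuppAntidiag]
      refine ⟨⟨?_, Finset.subset_univ _⟩, fun e he => ?_⟩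
      · simp [Fintype.sum_option, h2']
      · have := (h1 e e.2).2 he
        rw [hc] at this
        exact_mod_cast this.ne'
    · simp only [Finsupp.equivFunOnFinite_symm_apply_apply, Option.elim]
      simp_rw [← hc]
      exact hT.sum_cutFunctional_smul h0
  · rintro ⟨l, hl, rfl⟩
    rw [Finset.mem_coe, Finset.mem_filter, Finset.mem_finsuppAntidiag] at hl
    obtain ⟨⟨hl, -⟩, hA⟩ := hl
    refine ⟨sum_smul_edgeVector_mem_integerPoints fun e => l (some e), ?_, fun e he => ?_, ?_⟩
    · simp only [Finset.sum_apply, Pi.smul_apply]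
      rw [Finset.sum_comm]
      simp [← Finset.mul_sum, sum_edgeVector]
    · have := hT.cutFunctional_sum (fun e => (l (some e) : ℝ)) ⟨e, he⟩
      simp only at this
      rw [this]
      exact ⟨Nat.cast_nonneg _, fun h => Nat.cast_pos.2 (Nat.pos_of_ne_zero (hA ⟨e, he⟩ h))⟩
    · rw [height_apply]
      simp_rw [hT.cutFunctional_sum (fun e => (l (some e) : ℝ))]
      rw [Fintype.sum_option] at hl
      exact_mod_cast (by omega : ∑ e : T, l (some e) ≤ k)

lemma IsSpanningTree.finite_halfOpenPoints (hT : D.IsSpanningTree T) [Fintype T] (A : Set E)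
    (k : ℕ) : (D.halfOpenPoints T A k).Finite := by
  classical
  rw [hT.halfOpenPoints_eq_image]
  exact (Finset.finite_toSet _).image _

-- The parametrization is injective: the cut functionals recover the tree coordinates, and the total
-- `k` then fixes the slack.
open Classical in
lemma IsSpanningTree.ncard_halfOpenPoints (hT : D.IsSpanningTree T) [Fintype T] (A : Set E)
    (k : ℕ) : ((D.halfOpenPoints T A k).ncard : ℤ) = PowerSeries.coeff k
      (PowerSeries.X ^ (Finset.univ.filter fun e : T => (e : E) ∈ A).card *
        PowerSeries.mk (1 : ℕ → ℤ) ^ (Fintype.card T + 1)) := by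
  rw [hT.halfOpenPoints_eq_image, Set.InjOn.ncard_image, Set.ncard_coe_finset]
  · convert PowerSeries.card_filter_finsuppAntidiag (fun e : T => (e : E) ∈ A) k
  intro l hl m hm hlm
  have hsome : ∀ e, l (some e) = m (some e) := fun e => by
    have h1 := hT.cutFunctional_sum (fun e => (l (some e) : ℝ)) e
    have h2 := hT.cutFunctional_sum (fun e => (m (some e) : ℝ)) e
    simp only at hlm
    rw [hlm, h2] at h1
    exact_mod_cast h1.symm
  simp only [Finset.mem_coe, Finset.mem_filter, Finset.mem_finsuppAntidiag,
    Fintype.sum_option] at hl hm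
  ext (_ | e)
  · have := Finset.sum_congr (rfl : (Finset.univ : Finset T) = _) fun e _ => hsome e
    omega
  · exact hsome e

/-! ### The partition of the lattice points -/

section HalfOpen

variable [LinearOrder E]

/-- The half-open simplex of `T` consists of the points from which the motion towards the generic
point `q` starts into the interior of the simplex. -/
lemma IsSpanningTree.eventually_mem_smul (hT : D.IsSpanningTree T) [Fintype T] {q : V → ℝ}
    (hq0 : ∑ v, q v = 0) (hq1 : D.height T q < 1)
    (hq : ∀ e ∈ T, D.cutFunctional T e q ≠ 0 ∧
      (D.IsInternallySemiPassive T e ↔ D.cutFunctional T e q < 0))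
    {x : V → ℝ} (hxz : x ∈ integerPoints V) (hx : ∑ v, x v = 0) (k : ℕ) :
    ∀ᶠ δ in 𝓝[>] (0 : ℝ),
      (x + δ • q ∈ ((k : ℝ) + δ) • D.extendedRootPolytopeOf T →
        x ∈ D.halfOpenPoints T {e | D.IsInternallySemiPassive T e} k) ∧
      (x ∈ D.halfOpenPoints T {e | D.IsInternallySemiPassive T e} k →
        ((k : ℝ) + δ)⁻¹ • (x + δ • q) ∈ intrinsicInterior ℝ (D.extendedRootPolytopeOf T)) := by
  have hcut : ∀ᶠ δ in 𝓝[>] (0 : ℝ), ∀ e : T, _ := eventually_all.2 fun e =>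
    eventually_nonneg_add_mul (a := D.cutFunctional T e x) (hq e e.2).1
  -- The slack `k - height x` grows at rate `1 - height q > 0`, so the facet opposite to 0 is never
  -- removed.
  have hheight := eventually_nonneg_add_mul (a := k - D.height T x) (sub_pos.2 hq1).ne'
  filter_upwards [hcut, hheight, self_mem_nhdsWithin] with δ hcut hheight (hδ : 0 < δ)
  have hkδ : 0 < (k : ℝ) + δ := by positivity
  have hsum : ∑ v, (x + δ • q) v = 0 := by
    simp [Finset.sum_add_distrib, ← Finset.mul_sum, hx, hq0]
  constructor
  · intro h
    obtain ⟨-, h1, h2⟩ := (hT.mem_smul_extendedRootPolytopeOf_iff hkδ.le).1 h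
    simp only [map_add, map_smul, smul_eq_mul] at h1 h2
    refine ⟨hxz, hx, fun e he => ?_, ?_⟩
    · obtain ⟨h3, h4⟩ := (hcut ⟨e, he⟩).1 (h1 e he)
      exact ⟨h3, fun h => h4 ((hq e he).2.1 h)⟩
    · have := (hheight.1 (by linarith)).1
      linarith
  · rintro ⟨-, -, h1, h2⟩
    apply hT.mem_intrinsicInterior
    · simp only [Pi.smul_apply, smul_eq_mul, ← Finset.mul_sum, hsum, mul_zero]
    · intro e he
      rw [map_smul, map_add, map_smul, smul_eq_mul, smul_eq_mul]
      exact mul_pos (inv_pos.2 hkδ)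
        ((hcut ⟨e, he⟩).2 (h1 e he).1 fun h => (h1 e he).2 ((hq e he).2.2 h))
    · rw [map_smul, map_add, map_smul, smul_eq_mul, smul_eq_mul, inv_mul_lt_iff₀ hkδ]
      have := hheight.2 (by linarith) fun h => absurd h (sub_pos.2 hq1).not_gt
      linarith

variable [Fintype E] {𝒯 : Set (Set E)}

omit [Fintype V] [LinearOrder E] [Fintype E] in
lemma IsDissectingTreeSet.extendedRootPolytopeOf_subset (h𝒯 : D.IsDissectingTreeSet 𝒯)
    (hT : T ∈ 𝒯) : D.extendedRootPolytopeOf T ⊆ D.extendedRootPolytope := by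
  rw [← h𝒯.union_eq]
  exact Set.subset_biUnion_of_mem hT

variable [∀ T : Set E, Fintype T]

/-- Covering of the polytope gives the union, and disjointness of interiors gives the disjointness,
both tested at the perturbed point `x + δ • q`. -/
lemma IsDissectingTreeSet.smul_inter_integerPoints (h𝒯 : D.IsDissectingTreeSet 𝒯) (k : ℕ) :
    (k : ℝ) • D.extendedRootPolytope ∩ integerPoints V =
        ⋃ T ∈ 𝒯, D.halfOpenPoints T {e | D.IsInternallySemiPassive T e} k ∧
      𝒯.PairwiseDisjoint
        fun T => D.halfOpenPoints T {e | D.IsInternallySemiPassive T e} k := by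
  obtain ⟨q, hqP, hq⟩ := D.exists_generic_point
  have hq0 := sum_eq_zero_of_mem_extendedRootPolytopeOf hqP
  have key := fun (T : Set E) (hT : T ∈ 𝒯) (x : V → ℝ) =>
    (h𝒯.isSpanningTree T hT).eventually_mem_smul hq0 (hq T (h𝒯.isSpanningTree T hT)).1
      (hq T (h𝒯.isSpanningTree T hT)).2 (x := x)
  constructor
  · ext x
    simp only [Set.mem_iUnion, exists_prop]
    constructor
    · rintro ⟨hxP, hxz⟩
      have hx : ∑ v, x v = 0 := by
        obtain ⟨y, hy, rfl⟩ := hxP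
        simp [← Finset.mul_sum, sum_eq_zero_of_mem_extendedRootPolytopeOf hy]
      -- There are finitely many trees, so a single `δ` serves them all.
      have hall : ∀ᶠ δ in 𝓝[>] (0 : ℝ), ∀ T : 𝒯,
          x + δ • q ∈ ((k : ℝ) + δ) • D.extendedRootPolytopeOf (T : Set E) →
            x ∈ D.halfOpenPoints T {e | D.IsInternallySemiPassive T e} k :=
        eventually_all.2 fun T => (key T T.2 x hxz hx k).mono fun _ h => h.1
      obtain ⟨δ, hδ, hδ0⟩ := (hall.and self_mem_nhdsWithin).exists
      have hδ0 : 0 < δ := hδ0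
      -- By convexity, the `(k + δ)`-dilate is the Minkowski sum of the `k`- and `δ`-dilates.
      have hmem : x + δ • q ∈ ((k : ℝ) + δ) • D.extendedRootPolytope := by
        rw [extendedRootPolytope, (D.convex_extendedRootPolytopeOf Set.univ).add_smul
          k.cast_nonneg hδ0.le]
        exact Set.add_mem_add hxP (Set.smul_mem_smul_set hqP)
      rw [← h𝒯.union_eq] at hmem
      obtain ⟨y, hy, hyx⟩ := hmem
      simp only [Set.mem_iUnion, exists_prop] at hy
      obtain ⟨T, hT, hy⟩ := hy
      exact ⟨T, hT, hδ ⟨T, hT⟩ ⟨y, hy, hyx⟩⟩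
    · rintro ⟨T, hT, hx⟩
      exact ⟨Set.smul_set_mono (h𝒯.extendedRootPolytopeOf_subset hT)
        ((h𝒯.isSpanningTree T hT).halfOpenPoints_subset _ k hx), hx.1⟩
  · intro T hT T' hT' hne
    refine Set.disjoint_left.2 fun x hx hx' => ?_
    obtain ⟨δ, h, h'⟩ :=
      ((key T hT x hx.1 hx.2.1 k).and (key T' hT' x hx.1 hx.2.1 k)).exists
    exact Set.disjoint_left.1 (h𝒯.interiorDisjoint hT hT' hne) (h.2 hx) (h'.2 hx')

/-! ### Summation over the trees -/

omit [Fintype V] [DecidableEq V] [Fintype E] in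
open Classical in
lemma internalSemiPassivity_eq_card (T : Set E) : D.internalSemiPassivity T =
    (Finset.univ.filter fun e : T => (e : E) ∈ {e | D.IsInternallySemiPassive T e}).card := by
  rw [internalSemiPassivity, ← Set.ncard_coe_finset,
    ← Set.ncard_image_of_injective _ Subtype.val_injective]
  congr 1
  ext e
  simpa using fun h : D.IsInternallySemiPassive T e => h.1

lemma IsDissectingTreeSet.hStarSeries_eq (h𝒯 : D.IsDissectingTreeSet 𝒯) :
    hStarSeries D.extendedRootPolytope =
      ∑ T ∈ 𝒯.toFinite.toFinset, PowerSeries.X ^ D.internalSemiPassivity T := by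
  classical
  have hEhr : ehrhartSeries D.extendedRootPolytope =
      ∑ T ∈ 𝒯.toFinite.toFinset, PowerSeries.X ^ D.internalSemiPassivity T *
        PowerSeries.mk (1 : ℕ → ℤ) ^ (polytopeDim D.extendedRootPolytope + 1) := by
    ext k
    obtain ⟨h1, h2⟩ := h𝒯.smul_inter_integerPoints k
    rw [ehrhartSeries, PowerSeries.coeff_mk, h1, 𝒯.toFinite.ncard_biUnion
      (fun T hT => (h𝒯.isSpanningTree T hT).finite_halfOpenPoints _ k) h2,
      finsum_mem_eq_finite_toFinset_sum _ 𝒯.toFinite, map_sum, Nat.cast_sum]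
    refine Finset.sum_congr rfl fun T hT => ?_
    have hT := h𝒯.isSpanningTree T (by simpa using hT)
    rw [hT.ncard_halfOpenPoints, hT.polytopeDim_eq, internalSemiPassivity_eq_card]
  rw [hStarSeries, hEhr, Finset.mul_sum]
  refine Finset.sum_congr rfl fun T _ => ?_
  rw [mul_left_comm, ← mul_pow, mul_comm (1 - _), PowerSeries.mk_one_mul_one_sub_eq_one,
    one_pow, mul_one]

lemma IsDissectingTreeSet.coeff_hStarSeries (h𝒯 : D.IsDissectingTreeSet 𝒯) (i : ℕ) :
    PowerSeries.coeff i (hStarSeries D.extendedRootPolytope) =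
      ({T ∈ 𝒯 | D.internalSemiPassivity T = i}.ncard : ℤ) := by
  classical
  have : {T ∈ 𝒯 | D.internalSemiPassivity T = i} =
      (𝒯.toFinite.toFinset.filter fun T => D.internalSemiPassivity T = i : Finset (Set E)) := by
    ext T
    simp
  rw [h𝒯.hStarSeries_eq, map_sum, this, Set.ncard_coe_finset, Finset.card_filter, Nat.cast_sum]
  refine Finset.sum_congr rfl fun T _ => ?_
  simp [PowerSeries.coeff_X_pow, eq_comm]

-- With this bound, truncating the series above degree `d` loses nothing.
omit [Fintype E] in
lemma IsDissectingTreeSet.internalSemiPassivity_le (h𝒯 : D.IsDissectingTreeSet 𝒯)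
    (hT : T ∈ 𝒯) : D.internalSemiPassivity T ≤ polytopeDim D.extendedRootPolytope := by
  classical
  rw [(h𝒯.isSpanningTree T hT).polytopeDim_eq, internalSemiPassivity_eq_card]
  exact Finset.card_le_univ _

end HalfOpen

end MultiDigraph

/-- For a finite weakly connected digraph `D`, any dissecting tree set `𝒯` of `D` and any ordering
of the edges, the power series `(1 - t)^(d + 1) Ehr(t)` of the extended root polytope is the
polynomial `h*_D` (of degree at most `d`), and its `i`-th coefficient is the number of trees in `𝒯`
with exactly `i` internally semi-passive edges. -/
theorem mainTheorem5 {V E : Type*} [Finite V] [DecidableEq V] [Finite E] [LinearOrder E]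
    (D : MultiDigraph V E) (hD : D.IsWeaklyConnected)
    (𝒯 : Set (Set E)) (h𝒯 : D.IsDissectingTreeSet 𝒯) :
    (hStarPolynomial D.extendedRootPolytope : PowerSeries ℤ)
        = hStarSeries D.extendedRootPolytope ∧
      ∀ i : ℕ, (hStarPolynomial D.extendedRootPolytope).coeff i
        = ({T ∈ 𝒯 | D.internalSemiPassivity T = i}.ncard : ℤ) := by
  cases nonempty_fintype V
  cases nonempty_fintype E
  have : ∀ T : Set E, Fintype T := fun T => Fintype.ofFinite T
  have hpoly : (hStarPolynomial D.extendedRootPolytope : PowerSeries ℤ)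
      = hStarSeries D.extendedRootPolytope := by
    ext i
    rw [Polynomial.coeff_coe, hStarPolynomial, PowerSeries.coeff_trunc]
    split_ifs with hi
    · rfl
    · rw [h𝒯.coeff_hStarSeries, eq_comm, Nat.cast_eq_zero,
        Set.ncard_eq_zero (Set.toFinite _), Set.eq_empty_iff_forall_notMem]
      rintro T ⟨hT, rfl⟩
      exact hi (Nat.lt_succ_of_le (h𝒯.internalSemiPassivity_le hT))
  refine ⟨hpoly, fun i => ?_⟩
  rw [← Polynomial.coeff_coe, hpoly, h𝒯.coeff_hStarSeries]
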